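/- Let $X\sim N(\theta,\sigma^2 I_d)$ with $\sigma>0$ known, write $\mathbb P_\theta,\mathbb E_\theta$ for its law and expectation, and let $\Theta^+(s,a)=\{\theta\in\mathbb R^d:\|\theta\|_0\le s,\ \theta_j\ge a \text{ whenever } \theta_j\ne0\}$. For a random set $S=S(X)\subseteq[d]$ and bounds $L_j=L_j(X)$, $U_j=U_j(X)$ put $M(S,U,L)=\{\theta:\theta_j=0 \text{ for } j\notin S,\ L_j\le\theta_j\le U_j\text{ for } j\in S\}$ and $R(M,\Theta^+(s,a))=\sup_{1\le j\le d}\sup_{\theta\in\Theta^+(s,a)}\mathbb E_\theta(\theta_j-L_j)$. Fix $\alpha,\gamma\in(0,1)$, and put $\alpha'=\gamma\alpha$, $\beta=\alpha-\alpha'$, $C_{x,\beta}=2\sqrt{\pi\log(x/\beta)}$. Let $$\bar S^{ad}=\Big\{j\in[d]:X_j/\sigma\ge\sqrt{2\log\tfrac{2d}{\beta C_{d,\beta}}}\Big\},\qquad T=\lfloor\log_2 d\rfloor,$$ and $\hat s=2^{\hat m}$, where $\hat m\in\{1,\dots,T\}$ is such that $2^{\hat m-1}\le|\bar S^{ad}|<2^{\hat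 m}$ (with $\hat m=T$ if $|\bar S^{ad}|\ge2^T$; if $\bar S^{ad}=\emptyset$ the value is immaterial). The adaptive set $\hat M^{ad}_{\alpha'}=M(\bar S^{ad},\hat U,\hat L)$ has, for $j\in\bar S^{ad}$, $$\hat L_j=(X_j-u\sigma)_+,\quad u=\sqrt{2\log\tfrac{4\hat s}{\beta C_{2\hat s,\beta}}},\quad \hat U_j=+\infty,$$ and $\hat L_j=\hat U_j=0$ for $j\notin\bar S^{ad}$. It uses neither $s$ nor $a$. **Theorem.** There is a constant $C_0>0$, depending only on $\alpha$ and $\gamma$, such that for every $C'\ge C_0$, every $\sigma>0$, every $\delta\in(0,1)$, and all sequences $d,s\to\infty$ of integers with $2s\le d$ and all $a$ satisfying, for all large indices, $$\frac a\sigma\ \ge\ \sqrt{2\log(d-s)-\log\log(d-s)+C'}+\max\Big\{\sqrt{2\log s-\log\log s+C'},\ \sqrt{(2\log\log(d-s)-\log\log s)_+}\Big\},$$ the following hold. 1. $\hat M^{ad}_{\alpha'}$ belongs to the class $\mathcal M_+$ of one-sided sparse confidence sets, in the following sense. (a) Always $0\le\hat L_j\le X_j\vee0$ and $\hat U_j=+\infty$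 for $j\in\bar S^{ad}$, and $\hat L_j=\hat U_j=0$ for $j\notin\bar S^{ad}$; $\hat U_j$ depends on $X$ only through $X_j$, and $\hat L_j$ depends on $X$ only through $X_j$ and $\hat s$. (b) The event $\{j\in\bar S^{ad}\}$ depends only on $X_j$ and, for all large indices, $\mathbb P(j\in\bar S^{ad})\le1-\delta$ for every $j$ when $X_j\sim N(0,\sigma^2)$. (c) $\liminf_{d,s\to\infty}\ \inf_{\theta\in\Theta^+(s,a)}\mathbb P_\theta(\theta\in\hat M^{ad}_{\alpha'})\ge1-\alpha$. 2. $\displaystyle\limsup_{d,s\to\infty}\frac{R(\hat M^{ad}_{\alpha'},\Theta^+(s,a))}{\sigma\sqrt{2\log s}}\le1.$ -/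

import Mathlib

open MeasureTheory ProbabilityTheory Filter Topology

namespace SparseConf

noncomputable section

/-- The law `P_θ` of `X ∼ N(θ, σ² I)` on `ℝ^d`: independent coordinates `X_j ∼ N(θ_j, σ²)`. -/
def law (σ : ℝ) {d : ℕ} (θ : Fin d → ℝ) : Measure (Fin d → ℝ) :=
  Measure.pi fun j => gaussianReal (θ j) (σ ^ 2).toNNReal

/-- The one-sided sparse parameter space `Θ⁺(s, a)`: at most `s` nonzero coordinates, each of
which is at least `a`. -/
def thetaPlus (d s : ℕ) (a : ℝ) : Set (Fin d → ℝ) :=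
  {θ | hammingNorm θ ≤ s ∧ ∀ j, θ j ≠ 0 → a ≤ θ j}

/-- The data-dependent ingredients of a sparse confidence set `M(S, U, L)`: the random index set
`S(X)`, the lower bounds `L_j(X)` and the (possibly infinite) upper bounds `U_j(X)`. -/
structure SparseSet (d : ℕ) where
  S : (Fin d → ℝ) → Finset (Fin d)
  L : (Fin d → ℝ) → Fin d → ℝ
  U : (Fin d → ℝ) → Fin d → EReal

/-- The confidence set itself: `M(S, U, L) = {θ : θ_{Sᶜ} = 0 and θ_j ∈ [L_j, U_j] for j ∈ S}`. -/
def SparseSet.region {d : ℕ} (M : SparseSet d) (x : Fin d → ℝ) : Set (Fin d → ℝ) :=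
  {θ | (∀ j, j ∉ M.S x → θ j = 0) ∧
    ∀ j, j ∈ M.S x → (M.L x j : EReal) ≤ (θ j : EReal) ∧ (θ j : EReal) ≤ M.U x j}

/-- The class `F(δ)`: the event `{j ∈ S(X)}` depends on `X_j` only, and it has probability at most
`1 - δ` when `X_j ∼ N(0, σ²)`. -/
def classF (σ δ : ℝ) {d : ℕ} (S : (Fin d → ℝ) → Finset (Fin d)) : Prop :=
  ∀ j, ∃ A : Set ℝ, MeasurableSet A ∧ (∀ x, j ∈ S x ↔ x j ∈ A) ∧
    gaussianReal 0 (σ ^ 2).toNNReal A ≤ ENNReal.ofReal (1 - δ)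

/-- One-sided sparse confidence sets: `0 ≤ L_j ≤ X_j ∨ 0` and `U_j = +∞` for `j ∈ S`, while
`L_j = U_j = 0` for `j ∉ S`; `U_j` depends on `X_j` only, and `L_j` depends on `X_j` only once the
value of the statistic `τ(X)` is given. For a constant `τ` both bounds depend on `X_j` only. -/
structure ClassCI {d : ℕ} (τ : (Fin d → ℝ) → ℕ) (M : SparseSet d) : Prop where
  measurableSet_S : ∀ j, MeasurableSet {x | j ∈ M.S x}
  measurable_L : ∀ j, Measurable fun x => M.L x j
  U_separable : ∀ j x y, x j = y j → M.U x j = M.U y j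
  L_separable : ∀ j x y, x j = y j → τ x = τ y → M.L x j = M.L y j
  on_S : ∀ x j, j ∈ M.S x → 0 ≤ M.L x j ∧ M.L x j ≤ max (x j) 0 ∧ M.U x j = ⊤
  off_S : ∀ x j, j ∉ M.S x → M.L x j = 0 ∧ M.U x j = 0

/-- The class of sequences of one-sided sparse confidence sets that have asymptotic coverage
probability at least `1 - α` uniformly over `Θ⁺(s, a)` and whose index sets are in `F(δ)`
(for all sufficiently large `n`, the class being asymptotic). -/
structure ClassM (σ α δ : ℝ) (d s : ℕ → ℕ) (a : ℕ → ℝ)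
    (τ : ∀ n, (Fin (d n) → ℝ) → ℕ) (M : ∀ n, SparseSet (d n)) : Prop where
  one_sided : ∀ n, ClassCI (τ n) (M n)
  sparse : ∀ᶠ n in atTop, classF σ δ (M n).S
  coverage : ENNReal.ofReal (1 - α) ≤
    liminf (fun n => ⨅ θ ∈ thetaPlus (d n) (s n) (a n),
      law σ θ {x | θ ∈ (M n).region x}) atTop

/-- The criterion `R(M, Θ⁺(s, a)) = sup_j sup_{θ ∈ Θ⁺(s, a)} E_θ(θ_j - L_j)`. -/
def risk (σ : ℝ) {d : ℕ} (M : SparseSet d) (s : ℕ) (a : ℝ) : EReal :=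
  ⨆ j : Fin d, ⨆ θ ∈ thetaPlus d s a, ((∫ x, (θ j - M.L x j) ∂(law σ θ) : ℝ) : EReal)

/-- `C_{x, β} = 2 √(π log (x / β))`. -/
def tailC (x β : ℝ) : ℝ := 2 * √(Real.pi * Real.log (x / β))

/-- `√(2 log (2x / (β C_{x, β})))`. -/
def cut (x β : ℝ) : ℝ := √(2 * Real.log (2 * x / (β * tailC x β)))

/-- The selected index set: `X_j / σ ≥ √(2 log (2d / ((α - α') C_{d, α - α'})))`. -/
def adS (σ α α' : ℝ) {d : ℕ} (x : Fin d → ℝ) : Finset (Fin d) :=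
  {j | cut d (α - α') ≤ x j / σ}

/-- Rounding of `k` to the grid `{1, 2, …, 2^T}`, `2^T` being the largest power of two that is at
most `d`: the value is `2^m` for the `m` with `2^(m-1) ≤ k < 2^m`, and `2^T` when that `m`
exceeds `T`. (`Nat.size k` is the least `m` with `k < 2^m`.) -/
def dyadic (d k : ℕ) : ℕ := 2 ^ min (Nat.log 2 d) (Nat.size k)

theorem dyadic_eq {d k m : ℕ} (hm : 1 ≤ m) (hT : m ≤ Nat.log 2 d) (h1 : 2 ^ (m - 1) ≤ k)
    (h2 : k < 2 ^ m) : dyadic d k = 2 ^ m := by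
  have h3 : Nat.size k ≤ m := Nat.size_le.2 h2
  have h4 : m - 1 < Nat.size k := Nat.lt_size.2 h1
  have h5 : Nat.size k = m := by omega
  rw [dyadic, h5, min_eq_right hT]

/-- The sparsity estimate `ŝ`. -/
def sHat (σ α α' : ℝ) {d : ℕ} (x : Fin d → ℝ) : ℕ := dyadic d (adS σ α α' x).card

/-- The adaptive sparse confidence set: `L_j = (X_j - u σ)_+` with
`u = √(2 log (4ŝ / ((α - α') C_{2ŝ, α - α'})))` and `U_j = +∞` for selected `j`, and
`L_j = U_j = 0` otherwise. It is a function of `σ, α, α'` and the data only. -/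
def adaptive (σ α α' : ℝ) (d : ℕ) : SparseSet d where
  S x := adS σ α α' x
  L x j := if j ∈ adS σ α α' x then
    max (x j - cut (2 * (sHat σ α α' x : ℝ)) (α - α') * σ) 0 else 0
  U x j := if j ∈ adS σ α α' x then ⊤ else 0

/-- The lower bound on the signal-to-noise ratio `a / σ` in the high-SNR scenario, with
constant `C`. -/
def snrBound (C : ℝ) (d s : ℕ) : ℝ :=
  √(2 * Real.log ((d : ℝ) - s) - Real.log (Real.log ((d : ℝ) - s)) + C) +
    max √(2 * Real.log s - Real.log (Real.log s) + C)
      √(max (2 * Real.log (Real.log ((d : ℝ) - s)) - Real.log (Real.log s)) 0)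

end

end SparseConf

/-!
Write `β = α - α'`, so that `α = α' + β`, and let `l = log (x / β)`. The thresholds of the
construction satisfy `cut x β ^ 2 = 2 l - log l - log π`, and Mills' inequality gives
`P(Z ≥ cut x β) ≤ β / x` for every `x > β` (`normalTail_cut_le`), improving to
`(β / 2 + o(1)) / x` as `x → ∞` (`eventually_mul_normalTail_cut_le`).

*Coverage.* The signal-to-noise condition with `C ≥ 2 log (2 / β)` says that every nonzero `θ_j / σ`
exceeds the selection threshold by at least `t = √(2 log s - log log s + C)`
(`cut_add_max_le_of_snrBound_le`). By a union bound, some null coordinate is selected with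
probability at most `β / 2 + o(1)`, and some nonzero coordinate is missed with probability at most
`s P(Z ≥ t) ≤ exp (-C / 2)`. Outside these two events the selected set is the support of `θ`, of
size `k` say, so the estimate `ŝ` is a deterministic number larger than `k`, and a further union
bound over the support costs at most `k β / (2 ŝ) ≤ β / 2` (`mem_region_adaptive`,
`one_sub_le_law_region`). The slack `α'` in `α = α' + β` absorbs the `o(1)` and `exp (-C / 2)`.
No independence between coordinates is used, only the marginal laws.

*Risk.* A null coordinate contributes `-E L_j ≤ 0`. Let `u` be the random width. For `θ_j / σ` above
the selection threshold, `θ_j - L_j ≤ σ u - (X_j - θ_j) + θ_j 1{j ∉ S}` on every sample, because the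
noise is negative whenever such a coordinate is missed. The noise has mean zero. Since `u ≤ √(2 log (4 (|S| + 1) / β))` and `v ↦ √(2 log v)` lies below its tangents, the
expected width is at most `√(2 log (4 (s + 2) / β))` once `E|S| ≤ s + 1`
(`cut_dyadic_le_tangent`, `integral_sub_adaptive_L_le`). The last term is at most
`σ (b + c) P(Z ≥ b)`, with `c` the selection threshold and `b` the margin `θ_j / σ - c`; it is
bounded by `3 σ` thanks to the second entry of the maximum in the signal-to-noise condition
(`add_mul_normalTail_le`, `cut_mul_exp_le_two`). Dividing by `σ √(2 log s)` gives the limit `1`.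
-/

namespace SparseConf

/-! ### Gaussian tails -/

/-- The upper tail `P(Z ≥ t)` of a standard normal variable. -/
noncomputable def normalTail (t : ℝ) : ℝ := (gaussianReal 0 1).real (Set.Ici t)

theorem normalTail_nonneg (t : ℝ) : 0 ≤ normalTail t := measureReal_nonneg

/-- Mills' inequality: on `[t, ∞)` the density is at most `z / t` times itself, and that product
has the explicit antiderivative `-φ / t`. -/
theorem normalTail_le_mills {t : ℝ} (ht : 0 < t) :
    normalTail t ≤ (√(2 * Real.pi))⁻¹ * Real.exp (-t ^ 2 / 2) / t := by
  have hint : Integrable fun x : ℝ => x * Real.exp (-x ^ 2 / 2) := by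
    refine (integrable_mul_exp_neg_mul_sq (b := 1 / 2) (by norm_num)).congr ?_
    filter_upwards with x
    ring_nf
  have hlim : Tendsto (fun x : ℝ => -Real.exp (-x ^ 2 / 2)) atTop (𝓝 0) := by
    rw [← neg_zero]
    refine Tendsto.neg (Real.tendsto_exp_atBot.comp ?_)
    have := (tendsto_pow_atTop (α := ℝ) two_ne_zero).atTop_div_const (r := 2) two_pos
    refine (tendsto_neg_atTop_atBot.comp this).congr fun x => ?_
    simp only [Function.comp]
    ring
  have hI : ∫ x in Set.Ioi t, x * Real.exp (-x ^ 2 / 2) = Real.exp (-t ^ 2 / 2) := by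
    rw [integral_Ioi_of_hasDerivAt_of_tendsto' (f := fun x => -Real.exp (-x ^ 2 / 2))
      (fun x _ => ?_) hint.integrableOn hlim]
    · ring
    · have h1 : HasDerivAt (fun x : ℝ => -x ^ 2 / 2) (-x) x :=
        ((hasDerivAt_pow 2 x).fun_neg.div_const 2).congr_deriv (by simp; ring)
      exact h1.exp.fun_neg.congr_deriv (by ring)
  rw [normalTail, measureReal_def, gaussianReal_apply_eq_integral _ one_ne_zero,
    ENNReal.toReal_ofReal (integral_nonneg fun x => gaussianPDFReal_nonneg _ _ _),
    integral_Ici_eq_integral_Ioi]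
  calc ∫ x in Set.Ioi t, gaussianPDFReal 0 1 x
      ≤ ∫ x in Set.Ioi t, (√(2 * Real.pi))⁻¹ / t * (x * Real.exp (-x ^ 2 / 2)) := by
        refine setIntegral_mono_on (integrable_gaussianPDFReal 0 1).integrableOn
          (hint.const_mul _).integrableOn measurableSet_Ioi fun x hx => ?_
        have hx' : 1 ≤ x / t := (one_le_div ht).2 (le_of_lt hx)
        have h0 : 0 ≤ (√(2 * Real.pi))⁻¹ * Real.exp (-x ^ 2 / 2) := by positivity
        have h1 : gaussianPDFReal 0 1 x = (√(2 * Real.pi))⁻¹ * Real.exp (-x ^ 2 / 2) := by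
          simp [gaussianPDFReal]
        rw [h1]
        calc _ ≤ (x / t) * ((√(2 * Real.pi))⁻¹ * Real.exp (-x ^ 2 / 2)) :=
              le_mul_of_one_le_left h0 hx'
          _ = _ := by ring
    _ = _ := by
        rw [integral_const_mul, hI]
        ring

theorem inv_sqrt_two_pi_le_one : (√(2 * Real.pi))⁻¹ ≤ 1 := by
  refine inv_le_one_of_one_le₀ (Real.one_le_sqrt.2 ?_)
  nlinarith [Real.pi_gt_three]

/-- The tail at a level of the form `√(2 log y - log log y + c)`, which is the form of every
threshold of the construction. -/
theorem normalTail_sqrt_le {y c t : ℝ} (hy : 1 < y) (ht : 0 < t)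
    (h : t ^ 2 = 2 * Real.log y - Real.log (Real.log y) + c) :
    normalTail t ≤ (√(2 * Real.pi))⁻¹ * (√(Real.log y) * Real.exp (-c / 2) / y) / t := by
  have hl : 0 < Real.log y := Real.log_pos hy
  refine (normalTail_le_mills ht).trans_eq ?_
  have : -t ^ 2 / 2 = Real.log (Real.log y) / 2 + -c / 2 - Real.log y := by
    rw [h]; ring
  have hsqrt : Real.exp (Real.log (Real.log y) / 2) = √(Real.log y) := by
    rw [Real.exp_half, Real.exp_log hl]
  rw [this, Real.exp_sub, Real.exp_add, Real.exp_log (by linarith), hsqrt]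

theorem gaussianReal_map_standardize {σ : ℝ} (hσ : 0 < σ) (m : ℝ) :
    (gaussianReal m (σ ^ 2).toNNReal).map (fun y => (y - m) / σ) = gaussianReal 0 1 := by
  have h : (fun y : ℝ => (y - m) / σ) = (fun y => y / σ) ∘ fun y => y - m := rfl
  rw [h, ← Measure.map_map (by fun_prop) (by fun_prop), gaussianReal_map_sub_const,
    gaussianReal_map_div_const]
  congr 1
  · simp
  · ext
    have : (σ ^ 2 : ℝ) ≠ 0 := by positivity
    simp [Real.coe_toNNReal _ (sq_nonneg σ), this]

instance isProbabilityMeasure_law (σ : ℝ) {d : ℕ} (θ : Fin d → ℝ) :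
    IsProbabilityMeasure (law σ θ) := by
  unfold law; infer_instance

theorem measurePreserving_eval_law (σ : ℝ) {d : ℕ} (θ : Fin d → ℝ) (j : Fin d) :
    MeasurePreserving (fun x : Fin d → ℝ => x j) (law σ θ)
      (gaussianReal (θ j) (σ ^ 2).toNNReal) :=
  measurePreserving_eval (fun j => gaussianReal (θ j) (σ ^ 2).toNNReal) j

theorem measurePreserving_standardize_law {σ : ℝ} (hσ : 0 < σ) {d : ℕ} (θ : Fin d → ℝ)
    (j : Fin d) :
    MeasurePreserving (fun x : Fin d → ℝ => (x j - θ j) / σ) (law σ θ) (gaussianReal 0 1) := by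
  have h : MeasurePreserving (fun y : ℝ => (y - θ j) / σ)
      (gaussianReal (θ j) (σ ^ 2).toNNReal) (gaussianReal 0 1) :=
    ⟨by fun_prop, gaussianReal_map_standardize hσ _⟩
  exact h.comp (measurePreserving_eval_law σ θ j)

theorem law_real_upper {σ : ℝ} (hσ : 0 < σ) {d : ℕ} (θ : Fin d → ℝ) (j : Fin d) (t : ℝ) :
    (law σ θ).real {x | t ≤ (x j - θ j) / σ} = normalTail t :=
  (measurePreserving_standardize_law hσ θ j).measureReal_preimage
    measurableSet_Ici.nullMeasurableSet

theorem law_real_lower {σ : ℝ} (hσ : 0 < σ) {d : ℕ} (θ : Fin d → ℝ) (j : Fin d) (t : ℝ) :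
    (law σ θ).real {x | (x j - θ j) / σ ≤ -t} = normalTail t := by
  have hneg : MeasurePreserving (fun z : ℝ => -z) (gaussianReal 0 1) (gaussianReal 0 1) :=
    ⟨by fun_prop, by rw [gaussianReal_map_neg, neg_zero]⟩
  rw [normalTail, ← (hneg.comp (measurePreserving_standardize_law hσ θ j)).measureReal_preimage
    measurableSet_Ici.nullMeasurableSet]
  congr 1
  ext x
  simp only [Set.mem_ofPred_eq, Set.mem_preimage, Set.mem_Ici, Function.comp]
  constructor <;> intro h <;> linarith

theorem integrable_eval_law (σ : ℝ) {d : ℕ} (θ : Fin d → ℝ) (j : Fin d) :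
    Integrable (fun x : Fin d → ℝ => x j) (law σ θ) := by
  have h : Integrable (fun y : ℝ => y) (gaussianReal (θ j) (σ ^ 2).toNNReal) :=
    (memLp_id_gaussianReal 1).integrable le_rfl
  exact (measurePreserving_eval_law σ θ j).integrable_comp_of_integrable h

theorem integral_eval_law (σ : ℝ) {d : ℕ} (θ : Fin d → ℝ) (j : Fin d) :
    ∫ x, x j ∂(law σ θ) = θ j := by
  have h := measurePreserving_eval_law σ θ j
  have h2 := integral_map (μ := law σ θ) (φ := fun x : Fin d → ℝ => x j)
    h.measurable.aemeasurable (f := fun y : ℝ => y) (by fun_prop)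
  rw [h.map_eq, integral_id_gaussianReal] at h2
  exact h2.symm

/-! ### The threshold `cut` -/

theorem log_pi_mul_le {l : ℝ} (hl : 0 < l) : Real.log l + Real.log Real.pi ≤ 3 / 2 * l := by
  -- the tangent line of `log` at `5 / 2`, a point just below `e`
  have h1 := Real.log_le_sub_one_of_pos (x := l * Real.pi / (5 / 2)) (by positivity)
  rw [Real.log_div (by positivity) (by norm_num), Real.log_mul hl.ne' Real.pi_pos.ne'] at h1
  have h2 : Real.log (5 / 2) ≤ 1 := by
    rw [Real.log_le_iff_le_exp (by norm_num)]
    linarith [Real.exp_one_gt_d9]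
  have h3 : l * Real.pi ≤ l * 3.15 := by
    gcongr
    exact Real.pi_lt_d2.le
  linarith

theorem half_log_le_sq_cut_aux {l : ℝ} (hl : 0 < l) :
    l / 2 ≤ 2 * l - Real.log l - Real.log Real.pi := by
  linarith [log_pi_mul_le hl]

theorem sq_cut {x β : ℝ} (h : 1 < x / β) :
    cut x β ^ 2 = 2 * Real.log (x / β) - Real.log (Real.log (x / β)) - Real.log Real.pi := by
  have hl : 0 < Real.log (x / β) := Real.log_pos h
  have hpl : 0 < Real.pi * Real.log (x / β) := by positivity
  have h1 : 2 * x / (β * tailC x β) = x / β / √(Real.pi * Real.log (x / β)) := by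
    rw [tailC, div_div, mul_left_comm, mul_div_mul_left _ _ two_ne_zero]
  have h2 : 2 * Real.log (2 * x / (β * tailC x β))
      = 2 * Real.log (x / β) - Real.log (Real.log (x / β)) - Real.log Real.pi := by
    rw [h1, Real.log_div (by linarith) (by positivity), Real.log_sqrt hpl.le,
      Real.log_mul Real.pi_pos.ne' hl.ne']
    ring
  rw [cut, h2, Real.sq_sqrt]
  linarith [half_log_le_sq_cut_aux hl]

theorem cut_nonneg (x β : ℝ) : 0 ≤ cut x β := Real.sqrt_nonneg _

theorem half_log_le_sq_cut {x β : ℝ} (h : 1 < x / β) : Real.log (x / β) / 2 ≤ cut x β ^ 2 := by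
  rw [sq_cut h]
  exact half_log_le_sq_cut_aux (Real.log_pos h)

theorem cut_pos {x β : ℝ} (h : 1 < x / β) : 0 < cut x β := by
  have h1 := half_log_le_sq_cut h
  have h2 := Real.log_pos h
  exact (cut_nonneg x β).lt_of_ne' fun h0 => by rw [h0] at h1; norm_num at h1; linarith

theorem normalTail_cut_le_mul {x β : ℝ} (h : 1 < x / β) :
    normalTail (cut x β) ≤ (√(Real.log (x / β) / 2) / cut x β) / (x / β) := by
  refine (normalTail_sqrt_le (c := -Real.log Real.pi) h (cut_pos h)
    (by rw [sq_cut h]; ring)).trans_eq ?_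
  have h1 : Real.exp (- -Real.log Real.pi / 2) = √Real.pi := by
    rw [neg_neg, Real.exp_half, Real.exp_log Real.pi_pos]
  have hp : √Real.pi ≠ 0 := by positivity
  rw [h1, Real.sqrt_mul (by norm_num), Real.sqrt_div' _ (by norm_num)]
  field_simp

theorem normalTail_cut_le {x β : ℝ} (h : 1 < x / β) : normalTail (cut x β) ≤ (x / β)⁻¹ := by
  refine (normalTail_cut_le_mul h).trans ?_
  rw [div_eq_mul_inv]
  refine mul_le_of_le_one_left (by positivity) ((div_le_one (cut_pos h)).2 ?_)
  rw [← Real.sqrt_sq (cut_nonneg x β)]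
  exact Real.sqrt_le_sqrt (half_log_le_sq_cut h)

/-- A sharpening of `normalTail_cut_le` by an asymptotic factor `1 / 2`, because the threshold
`t = cut x β` satisfies `t² ∼ 2 log (x / β)`. -/
theorem eventually_mul_normalTail_cut_le {β ε : ℝ} (hβ : 0 < β) (hε : 0 < ε) :
    ∀ᶠ x : ℝ in atTop, x * normalTail (cut x β) ≤ β / 2 + ε := by
  have hl : Tendsto (fun x : ℝ => Real.log (x / β)) atTop atTop :=
    Real.tendsto_log_atTop.comp (tendsto_id.atTop_div_const hβ)
  have h1 : Tendsto (fun l : ℝ => β * √((1 / 2) /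
      (2 - Real.log l / l - Real.log Real.pi / l))) atTop (𝓝 (β * √((1 / 2) / (2 - 0 - 0)))) := by
    have hlog : Tendsto (fun l : ℝ => Real.log l / l) atTop (𝓝 0) :=
      Real.isLittleO_log_id_atTop.tendsto_div_nhds_zero
    have hc : Tendsto (fun l : ℝ => Real.log Real.pi / l) atTop (𝓝 0) :=
      tendsto_const_nhds.div_atTop tendsto_id
    refine ((Tendsto.div tendsto_const_nhds ((tendsto_const_nhds.sub hlog).sub hc)
      (by norm_num)).sqrt).const_mul β
  have h2 : β * √((1 / 2) / (2 - 0 - 0)) = β / 2 := by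
    have : ((1 : ℝ) / 2) / (2 - 0 - 0) = (1 / 2) ^ 2 := by norm_num
    rw [this, Real.sqrt_sq (by norm_num)]
    ring
  rw [h2] at h1
  have h3 := (h1.comp hl).eventually_le_const (show β / 2 < β / 2 + ε by linarith)
  filter_upwards [h3, eventually_gt_atTop β, eventually_gt_atTop 0] with x hx hxβ hx0
  have h : 1 < x / β := (one_lt_div hβ).2 hxβ
  have hl0 := Real.log_pos h
  refine le_trans ?_ hx
  calc x * normalTail (cut x β)
      ≤ x * ((√(Real.log (x / β) / 2) / cut x β) / (x / β)) := by
        gcongr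
        exact normalTail_cut_le_mul h
    _ = β * (√(Real.log (x / β) / 2) / √(cut x β ^ 2)) := by
        rw [Real.sqrt_sq (cut_nonneg x β)]
        field_simp
    _ = _ := by
        rw [← Real.sqrt_div (by positivity), sq_cut h]
        simp only [Function.comp]
        congr 2
        generalize Real.log (x / β) = l at hl0
        rw [show 2 - Real.log l / l - Real.log Real.pi / l
          = (2 * l - Real.log l - Real.log Real.pi) / l by field_simp, div_div_eq_mul_div]
        ring

/-- For `x ≥ 2` the correction `- log (π log (x / β))` in `cut x β ^ 2` is negative. -/
theorem sq_cut_le {x β : ℝ} (hβ : 0 < β) (hβ1 : β < 1) (hx : 2 ≤ x) :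
    cut x β ^ 2 ≤ 2 * Real.log (x / β) := by
  have h2 : 2 ≤ x / β := hx.trans (le_div_self (by linarith) hβ hβ1.le)
  have hl : 1 / 2 ≤ Real.log (x / β) :=
    le_trans (by linarith [Real.log_two_gt_d9]) (Real.log_le_log two_pos h2)
  rw [sq_cut (by linarith)]
  have h3 : 0 ≤ Real.log (Real.log (x / β) * Real.pi) :=
    Real.log_nonneg (by nlinarith [Real.pi_gt_three])
  rw [Real.log_mul (by linarith) Real.pi_pos.ne'] at h3
  linarith

/-- The selection threshold is within an additive constant, on the squared scale, of the one
computed from the number `d - s` of null coordinates, provided `2 s ≤ d`. -/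
theorem sq_cut_le_sub {d s β : ℝ} (hβ : 0 < β) (hβ1 : β < 1) (hds : 2 * s ≤ d)
    (h1 : 1 < d - s) (hs : 0 ≤ s) :
    cut d β ^ 2 ≤ 2 * Real.log (d - s) - Real.log (Real.log (d - s)) + 2 * Real.log (2 / β) := by
  have hd : d - s ≤ d / β := (by linarith : d - s ≤ d).trans (le_div_self (by linarith) hβ hβ1.le)
  have hl : 0 < Real.log (d - s) := Real.log_pos h1
  have hl2 : Real.log (d - s) ≤ Real.log (d / β) := Real.log_le_log (by linarith) hd
  have hl3 : Real.log (Real.log (d - s)) ≤ Real.log (Real.log (d / β)) := Real.log_le_log hl hl2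
  have hl4 : Real.log (d / β) ≤ Real.log (d - s) + Real.log (2 / β) := by
    rw [← Real.log_mul (by linarith) (by positivity)]
    refine Real.log_le_log (div_pos (by linarith) hβ) ?_
    rw [mul_div_assoc']
    gcongr
    linarith
  have hpi : 0 ≤ Real.log Real.pi := Real.log_nonneg (by linarith [Real.pi_gt_three])
  rw [sq_cut (by linarith)]
  linarith

/-! ### The selected set and the sparsity estimate -/

theorem mem_adS {σ α α' : ℝ} {d : ℕ} {x : Fin d → ℝ} {j : Fin d} :
    j ∈ adS σ α α' x ↔ cut d (α - α') ≤ x j / σ := by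
  simp [adS]

theorem measurableSet_mem_adS (σ α α' : ℝ) {d : ℕ} (j : Fin d) :
    MeasurableSet {x : Fin d → ℝ | j ∈ adS σ α α' x} := by
  simp only [mem_adS]
  exact measurableSet_le measurable_const (by fun_prop)

theorem card_adS_eq_sum (σ α α' : ℝ) {d : ℕ} (x : Fin d → ℝ) :
    (adS σ α α' x).card = ∑ j, {x : Fin d → ℝ | j ∈ adS σ α α' x}.indicator 1 x := by
  simp [Set.indicator_apply]

theorem measurable_card_adS (σ α α' : ℝ) {d : ℕ} :
    Measurable fun x : Fin d → ℝ => (adS σ α α' x).card := by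
  simp only [card_adS_eq_sum]
  exact Finset.measurable_sum _ fun j _ =>
    measurable_one.indicator (measurableSet_mem_adS σ α α' j)

theorem measurable_sHat (σ α α' : ℝ) {d : ℕ} :
    Measurable fun x : Fin d → ℝ => sHat σ α α' x :=
  (measurable_from_top (f := dyadic d)).comp (measurable_card_adS σ α α')

theorem measurable_adaptive_L (σ α α' : ℝ) {d : ℕ} (j : Fin d) :
    Measurable fun x => (adaptive σ α α' d).L x j := by
  refine Measurable.ite (measurableSet_mem_adS σ α α' j) ?_ measurable_const
  have : Measurable fun x : Fin d → ℝ => cut (2 * (sHat σ α α' x : ℝ)) (α - α') :=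
    (measurable_from_top (f := fun k : ℕ => cut (2 * (k : ℝ)) (α - α'))).comp
      (measurable_sHat σ α α')
  fun_prop

theorem classCI_adaptive {σ : ℝ} (hσ : 0 < σ) (α α' : ℝ) (d : ℕ) :
    ClassCI (sHat σ α α') (adaptive σ α α' d) where
  measurableSet_S := measurableSet_mem_adS σ α α'
  measurable_L := measurable_adaptive_L σ α α'
  U_separable j x y h := by simp only [adaptive, mem_adS, h]
  L_separable j x y h hτ := by simp only [adaptive, mem_adS, h, hτ]
  on_S x j hj := by
    have hj' : j ∈ adS σ α α' x := hj
    have := mul_nonneg (cut_nonneg (2 * (sHat σ α α' x : ℝ)) (α - α')) hσ.le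
    simp only [adaptive, hj', if_true]
    exact ⟨le_max_right _ _, max_le_max (by linarith) le_rfl, trivial⟩
  off_S x j hj := by
    have hj' : j ∉ adS σ α α' x := hj
    simp [adaptive, hj']

theorem lt_dyadic {d k : ℕ} (h : 2 * k ≤ d) : k < dyadic d k := by
  have h1 : Nat.size k ≤ Nat.log 2 d := by
    rw [Nat.size_le]
    have := Nat.lt_pow_succ_log_self one_lt_two d
    rw [pow_succ] at this
    omega
  rw [dyadic, min_eq_right h1]
  exact Nat.lt_size_self k

theorem one_le_dyadic (d k : ℕ) : 1 ≤ dyadic d k := Nat.one_le_two_pow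

theorem dyadic_le (d k : ℕ) : dyadic d k ≤ 2 * (k + 1) := by
  refine (Nat.pow_le_pow_right two_pos (min_le_right _ _)).trans ?_
  rcases h : Nat.size k with _ | m
  · omega
  · have : 2 ^ m ≤ k := Nat.lt_size.1 (by omega)
    rw [pow_succ]
    omega

/-- The random width is at most affine in the number of selected coordinates: this is the tangent
of the concave function `v ↦ √(2 log v)` at `v₀`, and it makes the expected width accessible through
the expected number of selections alone. -/
theorem cut_dyadic_le_tangent {β v₀ : ℝ} (hβ : 0 < β) (hβ1 : β < 1) (hv₀ : 1 < v₀) (d k : ℕ) :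
    cut (2 * (dyadic d k : ℝ)) β
      ≤ √(2 * Real.log v₀) + (4 * (k + 1) / β / v₀ - 1) / √(2 * Real.log v₀) := by
  set q := √(2 * Real.log v₀) with hq
  have hl := Real.log_pos hv₀
  have hq0 : 0 < q := Real.sqrt_pos.2 (by linarith)
  have hqq : q ^ 2 = 2 * Real.log v₀ := Real.sq_sqrt (by linarith)
  have h1 : (1 : ℝ) ≤ dyadic d k := by exact_mod_cast one_le_dyadic d k
  have h2 : (dyadic d k : ℝ) ≤ 2 * (k + 1) := by exact_mod_cast dyadic_le d k
  set v := 4 * ((k : ℝ) + 1) / β with hv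
  have hv0 : 0 < v := by positivity
  have h3 : cut (2 * (dyadic d k : ℝ)) β ^ 2 ≤ 2 * Real.log v := by
    refine (sq_cut_le hβ hβ1 (by linarith)).trans ?_
    rw [hv]
    gcongr 2 * Real.log (?_ / β)
    linarith
  have h4 := Real.log_le_sub_one_of_pos (x := v / v₀) (by positivity)
  rw [Real.log_div hv0.ne' (by linarith)] at h4
  rw [← sub_le_iff_le_add', le_div_iff₀ hq0]
  nlinarith [sq_nonneg (cut (2 * (dyadic d k : ℝ)) β - q)]

/-! ### Coverage -/

/-- If no null coordinate is selected and every nonzero one is, then the sparsity estimate is the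
deterministic number `dyadic d ‖θ‖₀`, so that coverage fails only if some nonzero coordinate has
noise above the corresponding deterministic threshold. -/
theorem mem_region_adaptive {σ α α' : ℝ} (hσ : 0 < σ) {d : ℕ} {θ x : Fin d → ℝ}
    (hθ : ∀ j, 0 ≤ θ j)
    (h0 : ∀ j, θ j = 0 → x j / σ < cut d (α - α'))
    (h1 : ∀ j, θ j ≠ 0 → cut d (α - α') ≤ x j / σ)
    (h2 : ∀ j, θ j ≠ 0 →
      (x j - θ j) / σ < cut (2 * (dyadic d (hammingNorm θ) : ℝ)) (α - α')) :
    θ ∈ (adaptive σ α α' d).region x := by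
  have hS : ∀ j, j ∈ adS σ α α' x ↔ θ j ≠ 0 := fun j => by
    rw [mem_adS]
    exact ⟨fun h h' => absurd h (not_le.2 (h0 j h')), h1 j⟩
  have hcard : (adS σ α α' x).card = hammingNorm θ := by
    rw [hammingNorm]
    congr 1
    ext j
    simp [hS]
  refine ⟨fun j hj => ?_, fun j hj => ?_⟩
  · by_contra h
    exact hj ((hS j).2 h)
  · have hj' : j ∈ adS σ α α' x := hj
    simp only [adaptive, hj', if_true, le_top, and_true, EReal.coe_le_coe_iff, sHat, hcard]
    refine max_le ?_ (hθ j)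
    have := h2 j ((hS j).1 hj')
    rw [div_lt_iff₀ hσ] at this
    linarith

theorem law_real_mem_adS {σ : ℝ} (hσ : 0 < σ) (α α' : ℝ) {d : ℕ} {θ : Fin d → ℝ} {j : Fin d}
    (h : θ j = 0) :
    (law σ θ).real {x | j ∈ adS σ α α' x} = normalTail (cut d (α - α')) := by
  rw [← law_real_upper hσ θ j]
  simp only [mem_adS, h, sub_zero]

theorem hammingNorm_mul_normalTail_le {β : ℝ} (hβ : 0 < β) (hβ1 : β < 1) {d k : ℕ}
    (h : 2 * k ≤ d) : k * normalTail (cut (2 * (dyadic d k : ℝ)) β) ≤ β / 2 := by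
  rcases Nat.eq_zero_or_pos k with rfl | hk
  · simp only [Nat.cast_zero, zero_mul]
    positivity
  have h1 : (k : ℝ) < dyadic d k := by exact_mod_cast lt_dyadic h
  have hk' : (1 : ℝ) ≤ k := by exact_mod_cast hk
  have h2 : 1 < 2 * (dyadic d k : ℝ) / β := (one_lt_div hβ).2 (by linarith)
  calc k * normalTail (cut (2 * (dyadic d k : ℝ)) β)
      ≤ dyadic d k * (2 * (dyadic d k : ℝ) / β)⁻¹ := by
        gcongr
        · exact normalTail_nonneg _
        · exact normalTail_cut_le h2
    _ = β / 2 := by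
        have : (dyadic d k : ℝ) ≠ 0 := by linarith
        field_simp

/-- The union bound over the three kinds of failure: a selected null coordinate, a missed nonzero
coordinate, and a nonzero coordinate whose lower bound overshoots. -/
theorem one_sub_le_law_region {σ α α' : ℝ} (hσ : 0 < σ) (hβ : 0 < α - α') (hβ1 : α - α' < 1)
    {d s : ℕ} (hds : 2 * s ≤ d) {a t : ℝ} (ha : 0 ≤ a) (hat : cut d (α - α') + t ≤ a / σ)
    {θ : Fin d → ℝ} (hθ : θ ∈ thetaPlus d s a) :
    1 - (d * normalTail (cut d (α - α')) + s * normalTail t + (α - α') / 2)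
      ≤ (law σ θ).real {x | θ ∈ (adaptive σ α α' d).region x} := by
  obtain ⟨hs, hθa⟩ := hθ
  have hθ0 : ∀ j, 0 ≤ θ j := fun j => by
    by_cases h : θ j = 0
    · exact h.ge
    · exact ha.trans (hθa j h)
  set u := cut (2 * (dyadic d (hammingNorm θ) : ℝ)) (α - α') with hu
  set F : Fin d → Set (Fin d → ℝ) := fun j => if θ j = 0 then {x | j ∈ adS σ α α' x} else
    {x | (x j - θ j) / σ ≤ -t} ∪ {x | u ≤ (x j - θ j) / σ} with hF
  set G := {x | θ ∈ (adaptive σ α α' d).region x} with hG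
  have hcover : (Set.univ : Set (Fin d → ℝ)) ⊆ G ∪ ⋃ j, F j := by
    intro x _
    by_contra hx
    rw [Set.mem_union, Set.mem_iUnion, not_or, not_exists] at hx
    refine hx.1 (mem_region_adaptive hσ hθ0 (fun j hj => ?_) (fun j hj => ?_) fun j hj => ?_)
    · have := hx.2 j
      simpa [hF, hj, mem_adS] using this
    · have := hx.2 j
      simp only [hF, hj, if_false, Set.mem_union, not_or, Set.mem_ofPred_eq, not_le] at this
      have h1 : a / σ ≤ θ j / σ := by
        gcongr
        exact hθa j hj
      have h2 := this.1
      rw [sub_div] at h2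
      linarith
    · have := hx.2 j
      simp only [hF, hj, if_false, Set.mem_union, not_or, Set.mem_ofPred_eq, not_le] at this
      exact this.2
  have hFj : ∀ j, (law σ θ).real (F j) ≤ normalTail (cut d (α - α')) +
      if θ j ≠ 0 then normalTail t + normalTail u else 0 := by
    intro j
    by_cases hj : θ j = 0
    · simp only [hF, hj, if_true, ne_eq, not_true, if_false, add_zero]
      exact (law_real_mem_adS hσ α α' hj).le
    · simp only [hF, hj, if_false, ne_eq, not_false_eq_true, if_true]
      refine (measureReal_union_le _ _).trans ?_
      rw [law_real_lower hσ, law_real_upper hσ]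
      linarith [normalTail_nonneg (cut d (α - α'))]
  have hsum : ∑ j, (law σ θ).real (F j) ≤ d * normalTail (cut d (α - α')) +
      hammingNorm θ * (normalTail t + normalTail u) := by
    refine (Finset.sum_le_sum fun j _ => hFj j).trans_eq ?_
    rw [Finset.sum_add_distrib, ← Finset.sum_filter, Finset.sum_const, Finset.sum_const,
      hammingNorm]
    simp [mul_add]
  have h1 : (1 : ℝ) ≤ (law σ θ).real G + ∑ j, (law σ θ).real (F j) := by
    calc (1 : ℝ) = (law σ θ).real Set.univ := by simp
      _ ≤ (law σ θ).real (G ∪ ⋃ j, F j) := measureReal_mono hcover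
      _ ≤ (law σ θ).real G + (law σ θ).real (⋃ j, F j) := measureReal_union_le _ _
      _ ≤ _ := by
        gcongr
        exact measureReal_iUnion_fintype_le F
  have h2 : hammingNorm θ * normalTail t ≤ s * normalTail t := by
    gcongr
    exact normalTail_nonneg t
  have h3 : hammingNorm θ * normalTail u ≤ (α - α') / 2 :=
    hammingNorm_mul_normalTail_le hβ hβ1 (by omega)
  linarith

/-! ### Risk -/

theorem integrable_card_adS (σ α α' : ℝ) {d : ℕ} (θ : Fin d → ℝ) :
    Integrable (fun x => ((adS σ α α' x).card : ℝ)) (law σ θ) := by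
  refine Integrable.of_bound
    (measurable_from_top.comp (measurable_card_adS σ α α')).aestronglyMeasurable (d : ℝ) ?_
  filter_upwards with x
  simpa using (adS σ α α' x).card_le_univ

theorem integral_card_adS_le {σ : ℝ} (hσ : 0 < σ) (α α' : ℝ) {d : ℕ} (θ : Fin d → ℝ) :
    ∫ x, ((adS σ α α' x).card : ℝ) ∂(law σ θ)
      ≤ hammingNorm θ + d * normalTail (cut d (α - α')) := by
  have h1 : ∀ x : Fin d → ℝ, ((adS σ α α' x).card : ℝ)
      = ∑ j, {x : Fin d → ℝ | j ∈ adS σ α α' x}.indicator (fun _ => (1 : ℝ)) x := fun x => by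
    simp [Set.indicator_apply]
  simp only [h1]
  rw [integral_finsetSum _ fun j _ =>
    (integrable_const _).indicator (measurableSet_mem_adS σ α α' j)]
  have h2 : ∀ j, ∫ x, {x : Fin d → ℝ | j ∈ adS σ α α' x}.indicator (fun _ => (1 : ℝ)) x ∂(law σ θ)
      ≤ normalTail (cut d (α - α')) + if θ j ≠ 0 then 1 else 0 := fun j => by
    rw [integral_indicator_const _ (measurableSet_mem_adS σ α α' j), smul_eq_mul, mul_one]
    by_cases hj : θ j = 0
    · simp [hj, law_real_mem_adS hσ α α' hj]
    · simp only [ne_eq, hj, not_false_eq_true, if_true]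
      linarith [normalTail_nonneg (cut d (α - α')),
        measureReal_le_one (μ := law σ θ) (s := {x | j ∈ adS σ α α' x})]
  refine (Finset.sum_le_sum fun j _ => h2 j).trans_eq ?_
  rw [Finset.sum_add_distrib, ← Finset.sum_filter, Finset.sum_const, Finset.sum_const, hammingNorm]
  simp [add_comm]

theorem adaptive_L_nonneg {σ : ℝ} (α α' : ℝ) {d : ℕ} (x : Fin d → ℝ) (j : Fin d) :
    0 ≤ (adaptive σ α α' d).L x j := by
  simp only [adaptive]
  split_ifs
  · exact le_max_right _ _
  · exact le_rfl

theorem integrable_adaptive_L {σ : ℝ} (hσ : 0 < σ) (α α' : ℝ) {d : ℕ} (θ : Fin d → ℝ)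
    (j : Fin d) : Integrable (fun x => (adaptive σ α α' d).L x j) (law σ θ) := by
  refine (integrable_eval_law σ θ j).norm.mono'
    (measurable_adaptive_L σ α α' j).aestronglyMeasurable ?_
  filter_upwards with x
  rw [Real.norm_of_nonneg (adaptive_L_nonneg α α' x j), Real.norm_eq_abs]
  have hci := classCI_adaptive hσ α α' d
  by_cases hj : j ∈ (adaptive σ α α' d).S x
  · exact (hci.on_S x j hj).2.1.trans (max_le (le_abs_self _) (abs_nonneg _))
  · rw [(hci.off_S x j hj).1]
    exact abs_nonneg _

/-- The excess `θ_j - L_j` is at most the width minus the noise when `j` is selected; when `j` is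
missed the noise is negative, so the same bound holds after adding `θ_j`. Taking expectations, the
noise drops out. -/
theorem integral_sub_adaptive_L_le {σ α α' : ℝ} (hσ : 0 < σ) (hβ : 0 < α - α')
    (hβ1 : α - α' < 1) {d s : ℕ} {θ : Fin d → ℝ} (hs : hammingNorm θ ≤ s)
    (hd : d * normalTail (cut d (α - α')) ≤ 1) {j : Fin d} (hj0 : 0 ≤ θ j)
    (hj : cut d (α - α') ≤ θ j / σ) :
    ∫ x, (θ j - (adaptive σ α α' d).L x j) ∂(law σ θ)
      ≤ σ * √(2 * Real.log (4 * (s + 2) / (α - α')))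
        + θ j * normalTail (θ j / σ - cut d (α - α')) := by
  set β := α - α' with hβdef
  set v₀ : ℝ := 4 * (s + 2) / β with hv₀
  have hv₀1 : 1 < v₀ := (one_lt_div hβ).2 (by have : (0 : ℝ) ≤ s := s.cast_nonneg; linarith)
  set q := √(2 * Real.log v₀) with hq
  have hq0 : 0 < q := Real.sqrt_pos.2 (by linarith [Real.log_pos hv₀1])
  set D : Set (Fin d → ℝ) := {x | (x j - θ j) / σ ≤ -(θ j / σ - cut d β)} with hD
  have hDm : MeasurableSet D := measurableSet_le (by fun_prop) measurable_const
  set A : (Fin d → ℝ) → ℝ := fun x =>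
    σ * (q + (4 * ((adS σ α α' x).card + 1) / β / v₀ - 1) / q) with hA
  have hpt : ∀ x : Fin d → ℝ, θ j - (adaptive σ α α' d).L x j
      ≤ A x - (x j - θ j) + D.indicator (fun _ => θ j) x := by
    intro x
    have hu := cut_dyadic_le_tangent hβ hβ1 hv₀1 d (adS σ α α' x).card
    rw [← hq] at hu
    simp only [hA]
    have hu' := mul_le_mul_of_nonneg_left hu hσ.le
    have hu0 := mul_nonneg hσ.le (cut_nonneg (2 * (dyadic d (adS σ α α' x).card : ℝ)) β)
    by_cases hx : j ∈ adS σ α α' x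
    · have h0 : 0 ≤ D.indicator (fun _ => θ j) x := Set.indicator_nonneg (fun _ _ => hj0) x
      have h1 : x j - cut (2 * (dyadic d (adS σ α α' x).card : ℝ)) β * σ
          ≤ (adaptive σ α α' d).L x j := by
        simp only [adaptive, hx, if_true]
        exact le_max_left _ _
      linarith
    · have hx' : x j / σ < cut d β := not_le.1 (mt mem_adS.2 hx)
      have hxD : x ∈ D := by
        change (x j - θ j) / σ ≤ -(θ j / σ - cut d β)
        rw [sub_div]
        linarith
      have hneg : x j - θ j ≤ 0 := by
        have : x j / σ ≤ θ j / σ := by linarith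
        linarith [(div_le_div_iff_of_pos_right hσ).1 this]
      rw [Set.indicator_of_mem hxD]
      linarith [adaptive_L_nonneg (σ := σ) α α' x j]
  have hcard := integrable_card_adS σ α α' θ
  have hx := integrable_eval_law σ θ j
  have hDi : Integrable (D.indicator fun _ => θ j) (law σ θ) :=
    (integrable_const _).indicator hDm
  have hlin : ∀ k : ℝ, σ * (q + (4 * (k + 1) / β / v₀ - 1) / q)
      = σ * (q + (4 / β / v₀ - 1) / q) + σ * (4 / β / v₀ / q) * k := fun k => by ring
  have hAi : Integrable A (law σ θ) := by
    simp only [hA, hlin]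
    exact (integrable_const _).add (hcard.const_mul _)
  have hcard_le : ∫ x, ((adS σ α α' x).card : ℝ) ∂(law σ θ) + 1 ≤ s + 2 := by
    have h1 := integral_card_adS_le hσ α α' θ
    have h2 : (hammingNorm θ : ℝ) ≤ s := by exact_mod_cast hs
    linarith
  have hE1 : ∫ x, A x ∂(law σ θ) ≤ σ * q := by
    simp only [hA, hlin]
    rw [integral_add (integrable_const _) (hcard.const_mul _),
      integral_const_mul (σ * (4 / β / v₀ / q))]
    simp only [integral_const, probReal_univ, one_smul]
    rw [← hlin]
    have : 4 * (∫ x, ((adS σ α α' x).card : ℝ) ∂(law σ θ) + 1) / β / v₀ ≤ 1 := by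
      rw [div_le_one (by linarith), hv₀]
      gcongr
    have h3 : (4 * (∫ x, ((adS σ α α' x).card : ℝ) ∂(law σ θ) + 1) / β / v₀ - 1) / q ≤ 0 :=
      div_nonpos_of_nonpos_of_nonneg (by linarith) hq0.le
    gcongr
    linarith
  have hmean : ∫ x, (x j - θ j) ∂(law σ θ) = 0 := by
    rw [integral_sub hx (integrable_const _), integral_eval_law]
    simp
  have hsub : Integrable (fun x : Fin d → ℝ => x j - θ j) (law σ θ) :=
    hx.sub (integrable_const _)
  have hAsub : Integrable (fun x => A x - (x j - θ j)) (law σ θ) := hAi.sub hsub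
  calc ∫ x, (θ j - (adaptive σ α α' d).L x j) ∂(law σ θ)
      ≤ ∫ x, (A x - (x j - θ j) + D.indicator (fun _ => θ j) x) ∂(law σ θ) :=
        integral_mono ((integrable_const _).sub (integrable_adaptive_L hσ α α' θ j))
          (hAsub.add hDi) hpt
    _ = ∫ x, A x ∂(law σ θ) + θ j * normalTail (θ j / σ - cut d β) := by
        rw [integral_add hAsub hDi, integral_sub hAi hsub, hmean,
          integral_indicator_const _ hDm, hD, law_real_lower hσ, smul_eq_mul]
        ring
    _ ≤ _ := by linarith

/-- The contribution of a missed coordinate stays bounded however large the coordinate is, since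
`b P(Z ≥ b)` does. -/
theorem add_mul_normalTail_le {b c K : ℝ} (hb : 1 ≤ b) (hc : 0 ≤ c)
    (hK : c * Real.exp (-b ^ 2 / 2) ≤ K) : (b + c) * normalTail b ≤ 1 + K := by
  have h1 : normalTail b ≤ Real.exp (-b ^ 2 / 2) / b := by
    refine (normalTail_le_mills (by linarith)).trans ?_
    have : (√(2 * Real.pi))⁻¹ * Real.exp (-b ^ 2 / 2) ≤ Real.exp (-b ^ 2 / 2) :=
      mul_le_of_le_one_left (Real.exp_pos _).le inv_sqrt_two_pi_le_one
    gcongr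
  have h2 : b * normalTail b ≤ 1 := by
    have := (le_div_iff₀ (by linarith)).1 h1
    have h3 : Real.exp (-b ^ 2 / 2) ≤ 1 := Real.exp_le_one_iff.2 (by nlinarith)
    linarith
  have h3 : c * normalTail b ≤ K := by
    refine le_trans ?_ hK
    gcongr
    exact h1.trans (div_le_self (Real.exp_pos _).le hb)
  linarith

theorem risk_adaptive_le {σ α α' : ℝ} (hσ : 0 < σ) (hβ : 0 < α - α') (hβ1 : α - α' < 1)
    {d s : ℕ} (hd : d * normalTail (cut d (α - α')) ≤ 1) {a b K : ℝ} (ha : 0 ≤ a) (hb : 1 ≤ b)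
    (hK : 0 ≤ K) (hab : cut d (α - α') + b ≤ a / σ)
    (hbK : cut d (α - α') * Real.exp (-b ^ 2 / 2) ≤ K) :
    risk σ (adaptive σ α α' d) s a
      ≤ ((σ * (√(2 * Real.log (4 * (s + 2) / (α - α'))) + (1 + K)) : ℝ) : EReal) := by
  refine iSup_le fun j => iSup₂_le fun θ hθ => EReal.coe_le_coe_iff.2 ?_
  obtain ⟨hs, hθa⟩ := hθ
  by_cases hj : θ j = 0
  · refine (integral_nonpos fun x => ?_).trans (by positivity)
    simp only [hj, zero_sub, Pi.zero_apply, Left.neg_nonpos_iff]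
    exact adaptive_L_nonneg α α' x j
  · have haj := hθa j hj
    have haσ : a / σ ≤ θ j / σ := by gcongr
    have hc := cut_nonneg (d : ℝ) (α - α')
    refine (integral_sub_adaptive_L_le hσ hβ hβ1 hs hd (ha.trans haj) (by linarith)).trans ?_
    rw [mul_add σ]
    refine add_le_add le_rfl ?_
    set b' := θ j / σ - cut d (α - α') with hb'
    have hbb : b ≤ b' := by linarith
    have hθb : θ j = σ * (b' + cut d (α - α')) := by
      rw [hb']; field_simp; ring
    rw [hθb, mul_assoc]
    refine mul_le_mul_of_nonneg_left ?_ hσ.le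
    refine add_mul_normalTail_le (hb.trans hbb) hc (le_trans ?_ hbK)
    gcongr

/-! ### The signal-to-noise condition -/

theorem cut_add_max_le_of_snrBound_le {β C r : ℝ} {d s : ℕ} (hβ : 0 < β) (hβ1 : β < 1)
    (hds : 2 * s ≤ d) (hs : 1 < (s : ℝ)) (hC : 2 * Real.log (2 / β) ≤ C)
    (h : snrBound C d s ≤ r) :
    cut d β + max √(2 * Real.log s - Real.log (Real.log s) + C)
      √(max (2 * Real.log (Real.log ((d : ℝ) - s)) - Real.log (Real.log s)) 0) ≤ r := by
  refine le_trans ?_ h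
  rw [snrBound]
  gcongr
  have hds' : 2 * (s : ℝ) ≤ d := by exact_mod_cast hds
  refine Real.le_sqrt_of_sq_le ((sq_cut_le_sub hβ hβ1 hds' (by linarith) (by linarith)).trans ?_)
  linarith

theorem log_le_sq_of_eq_sqrt {l C t : ℝ} (hl : 0 < l) (hC : 0 ≤ C)
    (ht : t = √(2 * l - Real.log l + C)) : t ^ 2 = 2 * l - Real.log l + C ∧ l ≤ t ^ 2 := by
  have h1 := Real.log_le_sub_one_of_pos hl
  have h2 : t ^ 2 = 2 * l - Real.log l + C := by
    rw [ht, Real.sq_sqrt (by linarith)]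
  exact ⟨h2, by linarith⟩

/-- The expected number of missed coordinates is at most `exp (-C / 2)`. -/
theorem mul_normalTail_sqrt_le {y C : ℝ} (hy : 1 < y) (hC : 0 ≤ C) :
    y * normalTail √(2 * Real.log y - Real.log (Real.log y) + C) ≤ Real.exp (-C / 2) := by
  set t := √(2 * Real.log y - Real.log (Real.log y) + C) with ht
  have hl := Real.log_pos hy
  obtain ⟨h1, h2⟩ := log_le_sq_of_eq_sqrt hl hC ht
  have ht0 : 0 ≤ t := Real.sqrt_nonneg _
  have ht1 : 0 < t := ht0.lt_of_ne' fun h => by rw [h] at h2; norm_num at h2; linarith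
  have h3 : √(Real.log y) ≤ t := by
    rw [← Real.sqrt_sq ht0]
    exact Real.sqrt_le_sqrt h2
  calc y * normalTail t
      ≤ y * ((√(2 * Real.pi))⁻¹ * (√(Real.log y) * Real.exp (-C / 2) / y) / t) := by
        gcongr
        exact normalTail_sqrt_le hy ht1 h1
    _ = (√(2 * Real.pi))⁻¹ * (√(Real.log y) / t) * Real.exp (-C / 2) := by
        field_simp
    _ ≤ 1 * 1 * Real.exp (-C / 2) := by
        gcongr
        · exact inv_sqrt_two_pi_le_one
        · exact (div_le_one ht1).2 h3
    _ = _ := by ring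

/-- The second term of the maximum in `snrBound` is what keeps `cut d β` times the normal density
bounded at the margin `b`. -/
theorem cut_mul_exp_le_two {β b d s : ℝ} (hβ : 0 < β) (hβ1 : β < 1) (hds : 2 * s ≤ d)
    (hs : 1 < s) (h1 : 1 ≤ Real.log s) (h2 : Real.log (2 / β) ≤ Real.log s)
    (hb : √(max (2 * Real.log (Real.log (d - s)) - Real.log (Real.log s)) 0) ≤ b) :
    cut d β * Real.exp (-b ^ 2 / 2) ≤ 2 := by
  have hl : Real.log s ≤ Real.log (d - s) := Real.log_le_log (by linarith) (by linarith)
  have hcut := sq_cut_le_sub hβ hβ1 hds (by linarith) (by linarith)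
  set l := Real.log s
  set L := Real.log (d - s)
  have hL : 0 < L := by linarith
  have hc : cut d β ≤ 2 * √L := by
    refine le_of_sq_le_sq ?_ (by positivity)
    rw [mul_pow, Real.sq_sqrt hL.le]
    linarith [Real.log_nonneg (h1.trans hl)]
  have hb2 : 2 * Real.log L - Real.log l ≤ b ^ 2 := by
    have h := pow_le_pow_left₀ (Real.sqrt_nonneg _) hb 2
    rw [Real.sq_sqrt (le_max_right _ _)] at h
    exact (le_max_left _ _).trans h
  have he : Real.exp (-b ^ 2 / 2) ≤ √l / L := by
    calc Real.exp (-b ^ 2 / 2) ≤ Real.exp (Real.log l / 2 - Real.log L) :=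
          Real.exp_le_exp.2 (by linarith)
      _ = _ := by
          rw [Real.exp_sub, Real.exp_half, Real.exp_log (by linarith), Real.exp_log hL]
  calc cut d β * Real.exp (-b ^ 2 / 2) ≤ 2 * √L * (√L / L) := by
        gcongr
        exact he.trans (by gcongr)
    _ = 2 * (√L * √L) / L := by ring
    _ = 2 := by
        rw [Real.mul_self_sqrt hL.le]
        field_simp

/-! ### The asymptotic statements -/

theorem classF_adS {σ δ α α' : ℝ} (hσ : 0 < σ) {d : ℕ}
    (h : normalTail (cut d (α - α')) ≤ 1 - δ) : classF σ δ (adS σ α α' (d := d)) := by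
  intro j
  refine ⟨{y | cut d (α - α') ≤ (y - 0) / σ}, measurableSet_le measurable_const (by fun_prop),
    fun x => by rw [mem_adS, Set.mem_ofPred_eq, sub_zero], ?_⟩
  have hmp : MeasurePreserving (fun y : ℝ => (y - 0) / σ)
      (gaussianReal 0 (σ ^ 2).toNNReal) (gaussianReal 0 1) :=
    ⟨by fun_prop, gaussianReal_map_standardize hσ 0⟩
  rw [ENNReal.le_ofReal_iff_toReal_le (measure_ne_top _ _) ((normalTail_nonneg _).trans h)]
  exact (hmp.measureReal_preimage measurableSet_Ici.nullMeasurableSet).trans_le h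

/-- The width bound at sparsity `s` plus a constant, relative to `√(2 log s)`. -/
theorem sqrt_log_add_div_le {β K s : ℝ} (hβ : 0 < β) (hs : 1 < s) :
    (√(2 * Real.log (4 * (s + 2) / β)) + K) / √(2 * Real.log s)
      ≤ √(1 + Real.log (12 / β) / Real.log s) + K / √(2 * Real.log s) := by
  have hl := Real.log_pos hs
  have h1 : Real.log (4 * (s + 2) / β) ≤ Real.log s + Real.log (12 / β) := by
    rw [← Real.log_mul (by linarith) (by positivity)]
    refine Real.log_le_log (by positivity) ?_
    rw [mul_div_assoc']
    gcongr ?_ / β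
    linarith
  rw [add_div, ← Real.sqrt_div' _ (by linarith)]
  gcongr
  rw [mul_div_mul_left _ _ two_ne_zero, div_le_iff₀ hl]
  have : (1 + Real.log (12 / β) / Real.log s) * Real.log s
      = Real.log s + Real.log (12 / β) := by field_simp
  rw [this]
  exact h1

theorem tendsto_sqrt_one_add_div (k K : ℝ) :
    Tendsto (fun l : ℝ => √(1 + k / l) + K / √(2 * l)) atTop (𝓝 1) := by
  have h1 : Tendsto (fun l : ℝ => √(1 + k / l)) atTop (𝓝 √(1 + 0)) :=
    ((tendsto_const_nhds.div_atTop tendsto_id).const_add 1).sqrt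
  have h2 : Tendsto (fun l : ℝ => K / √(2 * l)) atTop (𝓝 0) :=
    tendsto_const_nhds.div_atTop
      (Real.tendsto_sqrt_atTop.comp (tendsto_id.const_mul_atTop two_pos))
  simpa using h1.add h2

end SparseConf

theorem mainTheorem6 (α γ : ℝ) (hα : α ∈ Set.Ioo (0 : ℝ) 1) (hγ : γ ∈ Set.Ioo (0 : ℝ) 1) :
    ∃ C₀ : ℝ, 0 < C₀ ∧ ∀ C : ℝ, C₀ ≤ C →
      ∀ (σ δ : ℝ), 0 < σ → δ ∈ Set.Ioo (0 : ℝ) 1 →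
      ∀ (d s : ℕ → ℕ) (a : ℕ → ℝ),
        (∀ n, 2 * s n ≤ d n) → Tendsto s atTop atTop → Tendsto d atTop atTop →
        (∀ᶠ n in atTop, SparseConf.snrBound C (d n) (s n) ≤ a n / σ) →
        SparseConf.ClassM σ α δ d s a
            (fun _ => SparseConf.sHat σ α (γ * α))
            (fun n => SparseConf.adaptive σ α (γ * α) (d n)) ∧
          limsup (fun n =>
            SparseConf.risk σ (SparseConf.adaptive σ α (γ * α) (d n)) (s n) (a n) /
              ((σ * √(2 * Real.log (s n)) : ℝ) : EReal)) atTop ≤ 1 := by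
  obtain ⟨hα0, hα1⟩ := hα
  obtain ⟨hγ0, hγ1⟩ := hγ
  have hα' : 0 < γ * α := mul_pos hγ0 hα0
  have hβ : 0 < α - γ * α := by nlinarith
  have hβ1 : α - γ * α < 1 := by linarith
  set β := α - γ * α with hβdef
  have hlogβ : 0 < Real.log (2 / β) := Real.log_pos ((one_lt_div hβ).2 (by linarith))
  -- the first term lets the signal clear the selection threshold; the second keeps the
  -- probability of a miss below half of the slack `γ * α`
  refine ⟨max (2 * Real.log (2 / β)) (2 * Real.log (2 / (γ * α))),
    lt_max_of_lt_left (by linarith), ?_⟩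
  intro C hC σ δ hσ hδ d s a hds hs hd hsnr
  have hC1 : 2 * Real.log (2 / β) ≤ C := (le_max_left _ _).trans hC
  have hC2 : Real.exp (-C / 2) ≤ γ * α / 2 := by
    have h1 : 2 * Real.log (2 / (γ * α)) ≤ C := (le_max_right _ _).trans hC
    have h2 : Real.log (γ * α / 2) = -Real.log (2 / (γ * α)) := by
      rw [← Real.log_inv, inv_div]
    rw [← Real.le_log_iff_exp_le (by positivity), h2]
    linarith
  have hC0 : 0 ≤ C := by linarith
  have hsR : Tendsto (fun n => (s n : ℝ)) atTop atTop := tendsto_natCast_atTop_atTop.comp hs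
  have hdR : Tendsto (fun n => (d n : ℝ)) atTop atTop := tendsto_natCast_atTop_atTop.comp hd
  have hlog := Real.tendsto_log_atTop.comp hsR
  have hmargin : ∀ᶠ n in atTop, SparseConf.cut (d n) β +
      max √(2 * Real.log (s n) - Real.log (Real.log (s n)) + C)
        √(max (2 * Real.log (Real.log ((d n : ℝ) - s n)) - Real.log (Real.log (s n))) 0)
      ≤ a n / σ := by
    filter_upwards [hsnr, hsR.eventually_gt_atTop 1] with n h1 h2
    exact SparseConf.cut_add_max_le_of_snrBound_le hβ hβ1 (hds n) h2 hC1 h1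
  have ha : ∀ᶠ n in atTop, 0 ≤ a n := by
    filter_upwards [hmargin] with n h1
    have h2 : 0 ≤ a n / σ := le_trans (add_nonneg (SparseConf.cut_nonneg _ _)
      ((Real.sqrt_nonneg _).trans (le_max_left _ _))) h1
    rwa [le_div_iff₀ hσ, zero_mul] at h2
  have hfalse := hdR.eventually
    (SparseConf.eventually_mul_normalTail_cut_le hβ (show 0 < γ * α / 2 by positivity))
  have hfalse1 : ∀ᶠ n in atTop, d n * SparseConf.normalTail (SparseConf.cut (d n) β) ≤ 1 := by
    filter_upwards [hfalse] with n h1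
    linarith
  refine ⟨⟨fun n => SparseConf.classCI_adaptive hσ _ _ _, ?_, ?_⟩, ?_⟩
  · filter_upwards [hfalse1, hdR.eventually_ge_atTop (1 - δ)⁻¹, hdR.eventually_gt_atTop 0]
      with n h1 h2 h3
    refine SparseConf.classF_adS hσ ?_
    have hδ1 : 0 < 1 - δ := by linarith [hδ.2]
    rw [mul_comm, ← le_div_iff₀ h3] at h1
    refine h1.trans ?_
    rw [one_div]
    exact inv_le_of_inv_le₀ hδ1 h2
  · refine le_liminf_of_le (by isBoundedDefault) ?_
    filter_upwards [hmargin, ha, hfalse, hsR.eventually_gt_atTop 1] with n h1 h2 h3 h4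
    refine le_iInf₂ fun θ hθ => ENNReal.ofReal_le_of_le_toReal ?_
    refine le_trans ?_ (SparseConf.one_sub_le_law_region hσ hβ hβ1 (hds n) h2
      ((add_le_add_right (le_max_left _ _) _).trans h1) hθ)
    have h5 := SparseConf.mul_normalTail_sqrt_le h4 hC0
    linarith
  · have hbound : ∀ᶠ n in atTop,
        SparseConf.risk σ (SparseConf.adaptive σ α (γ * α) (d n)) (s n) (a n) /
          ((σ * √(2 * Real.log (s n)) : ℝ) : EReal)
        ≤ ((√(1 + Real.log (12 / β) / Real.log (s n)) + 3 / √(2 * Real.log (s n)) : ℝ)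
          : EReal) := by
      filter_upwards [hmargin, ha, hfalse1, hsR.eventually_gt_atTop 1,
        hlog.eventually_ge_atTop 1, hlog.eventually_ge_atTop (Real.log (2 / β))]
        with n h1 h2 h3 h4 h5 h6
      have hds' : 2 * (s n : ℝ) ≤ d n := by exact_mod_cast hds n
      have hl : 0 < √(2 * Real.log (s n)) := Real.sqrt_pos.2 (by linarith [Real.log_pos h4])
      have hb : 1 ≤ √(2 * Real.log (s n) - Real.log (Real.log (s n)) + C) := by
        have := (SparseConf.log_le_sq_of_eq_sqrt (Real.log_pos h4) hC0 rfl)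
        refine Real.one_le_sqrt.2 ?_
        rw [← this.1]
        exact h5.trans this.2
      have hr := SparseConf.risk_adaptive_le (s := s n) hσ hβ hβ1 h3 h2 (hb.trans (le_max_left _ _))
        zero_le_two h1 (SparseConf.cut_mul_exp_le_two hβ hβ1 hds' h4 h5 h6 (le_max_right _ _))
      refine (EReal.div_le_div_right_of_nonneg
        (EReal.coe_nonneg.2 (mul_pos hσ hl).le) hr).trans ?_
      rw [← EReal.coe_div, EReal.coe_le_coe_iff, mul_div_mul_left _ _ hσ.ne']
      have h7 := SparseConf.sqrt_log_add_div_le (K := 1 + 2) hβ h4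
      norm_num at h7 ⊢
      exact h7
    have hlim : Tendsto (fun n => ((√(1 + Real.log (12 / β) / Real.log (s n))
        + 3 / √(2 * Real.log (s n)) : ℝ) : EReal)) atTop (𝓝 ((1 : ℝ) : EReal)) :=
      (continuous_coe_real_ereal.tendsto _).comp
        ((SparseConf.tendsto_sqrt_one_add_div _ _).comp hlog)
    exact (limsup_le_limsup hbound).trans_eq hlim.limsup_eq
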